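/- For a group $G$ and an automorphism $\phi$ of $G$, let $R(\phi)\in\{1,2,\dots\}\cup\{\infty\}$ be the Reidemeister number of $\phi$, i.e. the number of classes of the equivalence relation $g\sim hg\phi(h^{-1})$ $(g,h\in G)$. We say that the twisted Burnside–Frobenius theorem $\mathrm{TBFT}_f$ holds for $G$ if, for every automorphism $\phi$ of $G$ with $R(\phi)<\infty$, the number $R(\phi)$ equals the number of (unitary) equivalence classes $[\rho]$ of finite-dimensional irreducible unitary representations of $G$ that are fixed by the map $[\rho]\mapsto[\rho\circ\phi]$. Write $\mathbb Z_m\,\mathrm{wr}\,\mathbb Z^k=\bigl(\bigoplus_{x\in\mathbb Z^k}\mathbb Z_m\bigr)\rtimes\mathbb Z^k$ for the restricted wreath product, where $\mathbb Z^k$ acts on the direct sum by shifts of the index. **Theorem.** $\mathrm{TBFT}_f$ holds for each of the following groups: 1. $\mathbb Z_m\,\mathrm{wr}\,\mathbb Z$, where $m\ge 1$ and $\gcd(m,6)=1$; 2. $\mathbb Z_p\,\mathrm{wr}\,\mathbb Z^k$, where $p>3$ is prime and $k\ge 0$; 3. $\mathbb Z_3\,\mathrm{wr}\,\mathbb Z^{2d}$,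 where $d\ge 0$. -/

import Mathlib

/-- The shift action of an additive group `X` on `⨁_{x ∈ X} A` (finitely supported functions
`X → A`, written multiplicatively): `shiftAction y` sends `a · δ_x` to `a · δ_{y + x}`. -/
noncomputable def shiftAction (A X : Type) [AddCommGroup A] [AddGroup X] :
    Multiplicative X →* MulAut (Multiplicative (X →₀ A)) where
  toFun y := AddEquiv.toMultiplicative (Finsupp.domCongr (Equiv.addLeft y.toAdd))
  map_one' := by
    ext f x
    simp [Finsupp.domCongr, Finsupp.equivMapDomain, Equiv.Perm.one_def]
  map_mul' y z := by
    ext f x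
    simp [Finsupp.domCongr, Finsupp.equivMapDomain, Equiv.Perm.mul_def]

/-- The restricted wreath product `A wr X = (⨁_{x ∈ X} A) ⋊ X`, where `X` acts by shifts. -/
abbrev RestrictedWreath (A X : Type) [AddCommGroup A] [AddGroup X] : Type :=
  Multiplicative (X →₀ A) ⋊[shiftAction A X] Multiplicative X

/-- The defining formula of the shift action: `α(y)(a δ_x) = a δ_{y + x}`. -/
theorem shiftAction_single (A X : Type) [AddCommGroup A] [AddGroup X] (y x : X) (a : A) :
    shiftAction A X (Multiplicative.ofAdd y) (Multiplicative.ofAdd (Finsupp.single x a)) =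
      Multiplicative.ofAdd (Finsupp.single (y + x) a) := by
  simp [shiftAction, Finsupp.domCongr, Finsupp.equivMapDomain_single]

/-- Twisted conjugacy with respect to an automorphism `φ`: `g ∼ h g φ(h⁻¹)`. -/
def reidemeisterSetoid {G : Type} [Group G] (φ : G ≃* G) : Setoid G where
  r g g' := ∃ h : G, g' = h * g * φ h⁻¹
  iseqv :=
    { refl := fun g => ⟨1, by simp⟩
      symm := by
        rintro g g' ⟨h, rfl⟩
        exact ⟨h⁻¹, by simp [mul_assoc]⟩
      trans := by
        rintro g g' g'' ⟨h, rfl⟩ ⟨k, rfl⟩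
        exact ⟨k * h, by simp [mul_assoc]⟩ }

/-- The Reidemeister number: the number of twisted conjugacy classes, `⊤` if infinite. -/
noncomputable def reidemeisterNumber {G : Type} [Group G] (φ : G ≃* G) : ℕ∞ :=
  ENat.card (Quotient (reidemeisterSetoid φ))

/-- A unitary representation of the (discrete) group `G` on the inner product space `V`. -/
abbrev UnitaryRep (G V : Type) [Group G] [NormedAddCommGroup V] [InnerProductSpace ℂ V] : Type :=
  G →* (V ≃ₗᵢ[ℂ] V)

/-- Irreducibility on a finite-dimensional space: `V ≠ 0`, and the only invariant subspaces are
`0` and `V`. -/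
def UnitaryRep.IsIrreducible {G V : Type} [Group G] [NormedAddCommGroup V] [InnerProductSpace ℂ V]
    (ρ : UnitaryRep G V) : Prop :=
  Nontrivial V ∧
    ∀ W : Submodule ℂ V, (∀ g : G, ∀ v ∈ W, ρ g v ∈ W) → W = ⊥ ∨ W = ⊤

/-- Unitary equivalence: there is a unitary operator `V → W` intertwining the representations. -/
def UnitaryRep.Equivalent {G V W : Type} [Group G]
    [NormedAddCommGroup V] [InnerProductSpace ℂ V] [NormedAddCommGroup W] [InnerProductSpace ℂ W]
    (ρ : UnitaryRep G V) (σ : UnitaryRep G W) : Prop :=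
  ∃ T : V ≃ₗᵢ[ℂ] W, ∀ (g : G) (v : V), T (ρ g v) = σ g (T v)

/-- The finite-dimensional irreducible unitary representations of `G`, realised on the standard
Hermitian spaces `ℂⁿ`. -/
structure FinDimIrrep (G : Type) [Group G] where
  dim : ℕ
  rep : UnitaryRep G (EuclideanSpace ℂ (Fin dim))
  irreducible : rep.IsIrreducible

/-- Every finite-dimensional irreducible unitary representation is unitarily equivalent to one on
a standard space `ℂⁿ`, so that no equivalence class is lost in `FinDimIrrep`. -/
theorem FinDimIrrep.exists_equivalent {G V : Type} [Group G] [NormedAddCommGroup V]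
    [InnerProductSpace ℂ V] [FiniteDimensional ℂ V] (ρ : UnitaryRep G V)
    (hρ : ρ.IsIrreducible) : ∃ σ : FinDimIrrep G, ρ.Equivalent σ.rep := by
  let T := (stdOrthonormalBasis ℂ V).repr
  let σ : UnitaryRep G (EuclideanSpace ℂ (Fin (Module.finrank ℂ V))) :=
    { toFun := fun g => (T.symm.trans (ρ g)).trans T
      map_one' := by ext1 v; simp
      map_mul' := fun g h => by ext1 v; simp }
  have hσ : ∀ g v, σ g v = T (ρ g (T.symm v)) := fun g v => rfl
  refine ⟨⟨_, σ, ?_, ?_⟩, T, fun g v => by simp [hσ]⟩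
  · have := hρ.1
    exact T.symm.toEquiv.nontrivial
  · intro W hW
    have hinj : Function.Surjective T.toLinearEquiv.toLinearMap := T.surjective
    rcases hρ.2 (W.comap T.toLinearEquiv.toLinearMap) (fun g v hv => by
      have := hW g (T v) hv
      simpa [hσ] using this) with h | h
    · left
      rw [← Submodule.map_comap_eq_of_surjective hinj W, h, Submodule.map_bot]
    · right
      rw [← Submodule.map_comap_eq_of_surjective hinj W, h, Submodule.map_top,
        LinearMap.range_eq_top.2 hinj]

instance finDimIrrepSetoid (G : Type) [Group G] : Setoid (FinDimIrrep G) where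
  r ρ σ := ρ.rep.Equivalent σ.rep
  iseqv :=
    { refl := fun ρ => ⟨LinearIsometryEquiv.refl ℂ _, fun _ _ => rfl⟩
      symm := by
        rintro ρ σ ⟨T, hT⟩
        exact ⟨T.symm, fun g v => T.injective (by simp [hT])⟩
      trans := by
        rintro ρ σ τ ⟨T, hT⟩ ⟨S, hS⟩
        exact ⟨T.trans S, fun g v => by simp [hT, hS]⟩ }

/-- The finite-dimensional part of the unitary dual of `G`: the set of unitary equivalence classes
of finite-dimensional irreducible unitary representations. -/
abbrev FinDimUnitaryDual (G : Type) [Group G] : Type :=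
  Quotient (finDimIrrepSetoid G)

/-- The representation `ρ ∘ φ`. -/
noncomputable def FinDimIrrep.twist {G : Type} [Group G] (φ : G ≃* G) (ρ : FinDimIrrep G) : FinDimIrrep G where
  dim := ρ.dim
  rep := ρ.rep.comp φ.toMonoidHom
  irreducible := ⟨ρ.irreducible.1, fun W hW => ρ.irreducible.2 W fun g v hv => by
    simpa using hW (φ.symm g) v hv⟩

/-- The map `[ρ] ↦ [ρ ∘ φ]` on equivalence classes. -/
noncomputable def dualMap {G : Type} [Group G] (φ : G ≃* G) : FinDimUnitaryDual G → FinDimUnitaryDual G :=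
  Quotient.map (FinDimIrrep.twist φ) (by
    rintro ρ σ ⟨T, hT⟩
    exact ⟨T, fun g v => hT (φ g) v⟩)

/-- The property TBFT_f: for each automorphism `φ` with `R(φ) < ∞`, the number `R(φ)` equals the
number of fixed points of `[ρ] ↦ [ρ ∘ φ]` on the finite-dimensional part of the unitary dual. -/
def TBFTf (G : Type) [Group G] : Prop :=
  ∀ φ : G ≃* G, reidemeisterNumber φ < ⊤ →
    reidemeisterNumber φ = ENat.card (Function.fixedPoints (dualMap φ))

/-! Let G = ℤ/m wr X with m ≥ 1 and X finitely generated torsion-free abelian. The base group is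
torsion and X is not, so an automorphism has the form φ(f, x) = (F f + b x, α x) with F semilinear
over α. If R(φ) < ∞, then X/(1-α)X is finite, hence 1-α is injective, and comparing classes over a
fixed z ∈ X shows that 1-L has finite cokernel for every L = (shift by z) ∘ F.

The heart is `surjective_id_sub_of_finite_quotient`: for X ≠ 0 such a cokernel vanishes. Otherwise
it is not p-divisible for some prime p ∣ m. Modulo p, L sends δ_0 to a unit of 𝔽_p[X], hence to a
monomial c·δ_w, so up to the scalar c it permutes the points by β x = α x + w. A homothety commuting
with β carries any point x other than its centre through infinitely many β-orbits. Finiteness makes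
two of the resulting δ's congruent modulo the image of 1-L, and separating the orbits puts δ_x
itself in that image modulo p. The centre, if it lies in X, is handled by the sum of coefficients.

So the twisted classes are the fibres of G → Q = X/(1-α)X (for X = 0, with Q = coker(1-F)). If S
intertwines an irreducible ρ with ρ∘φ, then g ↦ tr(S ρ(g)) is constant on these classes, and
Burnside's theorem makes ρ factor through Q. The fixed representations are thus the characters of Q,
and both counts equal |Q|. -/

/-! ### Units of group algebras. -/

/-- A unit of the group algebra of a group with two unique sums over a field is a monomial. -/
theorem AddMonoidAlgebra.exists_eq_single_of_isUnit {K X : Type} [Field K] [AddCommGroup X]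
    [TwoUniqueSums X] {u : AddMonoidAlgebra K X} (hu : IsUnit u) :
    ∃ x c, u = AddMonoidAlgebra.single x c := by
  classical
  obtain ⟨v, huv⟩ := hu.exists_right_inv
  have hu0 : u.coeff.support.Nonempty := by
    rw [Finsupp.support_nonempty_iff, Ne, AddMonoidAlgebra.coeff_eq_zero]
    rintro rfl
    simp at huv
  have hv0 : v.coeff.support.Nonempty := by
    rw [Finsupp.support_nonempty_iff, Ne, AddMonoidAlgebra.coeff_eq_zero]
    rintro rfl
    simp at huv
  have hcard : ¬ 1 < u.coeff.support.card * v.coeff.support.card := by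
    intro h
    obtain ⟨p, hp, q, hq, hpq, hup, huq⟩ := TwoUniqueSums.uniqueAdd_of_one_lt_card h
    rw [Finset.mem_product] at hp hq
    -- The coefficient of uv = 1 at a unique sum is a nonzero product, so that sum is 0. Two
    -- distinct unique sums would therefore coincide.
    have key : ∀ r : X × X, r.1 ∈ u.coeff.support → r.2 ∈ v.coeff.support →
        UniqueAdd u.coeff.support v.coeff.support r.1 r.2 → r.1 + r.2 = 0 := by
      intro r h1 h2 h3
      have h4 := AddMonoidAlgebra.coeff_mul_add_of_uniqueAdd h3
      rw [huv, AddMonoidAlgebra.one_def, AddMonoidAlgebra.coeff_single] at h4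
      by_contra h5
      rw [Finsupp.single_apply, if_neg (Ne.symm h5)] at h4
      exact mul_ne_zero (Finsupp.mem_support_iff.1 h1) (Finsupp.mem_support_iff.1 h2) h4.symm
    have h5 := hup hq.1 hq.2 ((key q hq.1 hq.2 huq).trans (key p hp.1 hp.2 hup).symm)
    exact hpq (Prod.ext h5.1.symm h5.2.symm)
  have h1 : u.coeff.support.card = 1 := by
    have := hu0.card_pos
    have := hv0.card_pos
    nlinarith
  obtain ⟨x, c, -, hc⟩ := Finsupp.card_support_eq_one'.1 h1
  exact ⟨x, c, AddMonoidAlgebra.coeff_injective hc⟩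

/-! ### Orbits of affine permutations. -/

/-- If `δ_{D x} - δ_{x'}` lies in the image of `f ↦ f - c · (f ∘ β⁻¹)`, where the injection `D`
commutes with `β` and `x'` is not in the `β`-orbit of `D x`, then so does `δ_x`. -/
theorem exists_twistedDifference_eq_single {K X : Type} [Field K] {β : Equiv.Perm X}
    {c : K} {D : X → X} (hD : D.Injective) (hDβ : ∀ x, D (β x) = β (D x)) {x x' : X}
    (hx : ¬ β.SameCycle (D x) x') (f : X →₀ K)
    (hf : ∀ y, f y - c * f (β.symm y) = Finsupp.single (D x) 1 y - Finsupp.single x' 1 y) :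
    ∃ g : X →₀ K, ∀ y, g y - c * g (β.symm y) = Finsupp.single x 1 y := by
  classical
  -- Restricting f to the orbit of D x respects the equation and removes δ_{x'}; pulling back along
  -- D turns δ_{D x} into δ_x.
  refine ⟨(f.filter (β.SameCycle (D x))).comapDomain D hD.injOn, fun y => ?_⟩
  have h1 : D (β.symm y) = β.symm (D y) := by
    rw [Equiv.eq_symm_apply, ← hDβ, Equiv.apply_symm_apply]
  have h2 : β.SameCycle (D x) (β.symm (D y)) ↔ β.SameCycle (D x) (D y) :=
    Equiv.Perm.sameCycle_symm_apply_right
  rw [Finsupp.comapDomain_apply, Finsupp.comapDomain_apply, h1, Finsupp.filter_apply,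
    Finsupp.filter_apply, h2]
  by_cases h : β.SameCycle (D x) (D y)
  · rw [if_pos h, if_pos h, hf, Finsupp.single_apply (a := x'), if_neg, sub_zero]
    · simp only [Finsupp.single_apply, hD.eq_iff]
    · rintro rfl
      exact hx h
  · rw [if_neg h, if_neg h, Finsupp.single_apply, if_neg]
    · simp
    · rintro rfl
      exact h (Equiv.Perm.SameCycle.refl _ _)

/-- A predicate invariant under a permutation is constant on its orbits. -/
theorem Equiv.Perm.SameCycle.iff_of_invariant {X : Type} {β : Equiv.Perm X} {P : X → Prop}
    (hP : ∀ x, P (β x) ↔ P x) {a b : X} (h : β.SameCycle a b) : P a ↔ P b := by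
  obtain ⟨s, rfl⟩ := h
  induction s using Int.induction_on with
  | zero => rfl
  | succ n ih => rw [ih, add_comm, zpow_add, zpow_one, Equiv.Perm.mul_apply, hP]
  | pred n ih =>
    rw [ih, ← hP ((β ^ (-(n : ℤ) - 1)) a), ← Equiv.Perm.mul_apply]
    nth_rw 2 [← zpow_one β]
    rw [← zpow_add, add_sub_cancel]

/-- In a finitely generated torsion-free abelian group, only `0` is divisible by all powers of
`b ≥ 2`. -/
theorem eq_zero_of_forall_pow_smul {X : Type} [AddCommGroup X] [Module.Finite ℤ X]
    [IsAddTorsionFree X] {b : ℕ} (hb : 2 ≤ b) {v : X} (h : ∀ k : ℕ, ∃ w, v = b ^ k • w) :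
    v = 0 := by
  let B := Module.Free.chooseBasis ℤ X
  refine B.ext_elem fun i => ?_
  rw [map_zero, Finsupp.zero_apply]
  -- A coordinate a is divisible by b^|a| > |a|, so it vanishes.
  refine Int.eq_zero_of_abs_lt_dvd (m := b ^ (B.repr v i).natAbs) ?_ ?_
  · obtain ⟨w, hw⟩ := h (B.repr v i).natAbs
    refine ⟨B.repr w i, ?_⟩
    conv_lhs => rw [hw]
    simp
  · rw [Int.abs_eq_natAbs]
    exact_mod_cast Nat.lt_pow_self (by lia)

/-- In a finitely generated torsion-free abelian group, multiples of `v ≠ 0` by distinct powers of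
`b ≥ 2` are distinguished by their divisibility by powers of `b`. -/
theorem eq_zero_of_pow_smul_dvd_iff {X : Type} [AddCommGroup X] [Module.Finite ℤ X]
    [IsAddTorsionFree X] {b : ℕ} (hb : 2 ≤ b) {v : X} {i j : ℕ} (hij : i < j)
    (h : ∀ k : ℕ, (∃ w, b ^ i • v = b ^ k • w) ↔ ∃ w, b ^ j • v = b ^ k • w) : v = 0 := by
  have hb0 : ∀ e : ℕ, b ^ e ≠ 0 := fun e => pow_ne_zero _ (by lia)
  have key : ∀ k : ℕ, ∃ w, v = b ^ k • w := by
    intro k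
    induction k with
    | zero => exact ⟨v, by simp⟩
    | succ k ih =>
      obtain ⟨w, hw⟩ := ih
      -- From b^k ∣ v follows b^(j+k) ∣ b^j v, hence b^(j+k) ∣ b^i v; cancelling b^i gains a factor
      -- b, as i < j.
      obtain ⟨w', hw'⟩ := (h (j + k)).2 ⟨w, by rw [pow_add, mul_smul, ← hw]⟩
      refine ⟨b ^ (j - i - 1) • w', ?_⟩
      refine (nsmul_right_injective (hb0 i)) ?_
      simp only
      rw [hw', ← mul_smul, ← mul_smul, ← pow_add, ← pow_add]
      congr 2
      lia
  exact eq_zero_of_forall_pow_smul hb key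

/-- Let `β x = α x + w` be an affine automorphism of a finitely generated torsion-free abelian
group with a rational fixed point `n⁻¹ y`.  If `n x ≠ y`, then the points obtained from `x` by
iterating the homothety with ratio `1 + n` and centre `n⁻¹ y` are in distinct orbits. -/
theorem not_sameCycle_iterate_homothety {X : Type} [AddCommGroup X] [Module.Finite ℤ X]
    [IsAddTorsionFree X] (α : X ≃+ X) {β : Equiv.Perm X} {w y : X} (hβ : ∀ x, β x = α x + w)
    {n : ℕ} (hn : 0 < n) (hy : α y + n • w = y) {x : X} (hx : n • x ≠ y) {i j : ℕ} (hij : i ≠ j) :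
    ¬ β.SameCycle ((fun x => x + (n • x - y))^[i] x) ((fun x => x + (n • x - y))^[j] x) := by
  wlog hlt : i < j generalizing i j
  · exact fun h => this hij.symm (lt_of_le_of_ne (not_lt.1 hlt) hij.symm) h.symm
  intro h
  have hit : ∀ t, n • ((fun x => x + (n • x - y))^[t] x) - y = (1 + n) ^ t • (n • x - y) := by
    intro t
    induction t with
    | zero => simp
    | succ t ih =>
      rw [Function.iterate_succ_apply', smul_add, ih, pow_succ', mul_smul, ← ih, add_smul, one_smul]
      abel
  have hαv : ∀ x, n • β x - y = α (n • x - y) := by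
    intro x
    rw [hβ, map_sub, map_nsmul, smul_add]
    nth_rw 1 [← hy]
    abel
  refine hx (sub_eq_zero.1 (eq_zero_of_pow_smul_dvd_iff (b := 1 + n) (by lia) hlt fun k => ?_))
  rw [← hit, ← hit]
  -- The vector n z - y is transformed by the automorphism α when β is applied to z, so its
  -- divisibility is constant on β-orbits.
  refine h.iff_of_invariant (P := fun z => ∃ u, n • z - y = (1 + n) ^ k • u) fun z => ?_
  rw [hαv]
  constructor
  · rintro ⟨u, hu⟩
    exact ⟨α.symm u, by rw [← map_nsmul, ← hu, α.symm_apply_apply]⟩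
  · rintro ⟨u, hu⟩
    exact ⟨α u, by rw [hu, map_nsmul]⟩

/-! ### Reduction of coefficients to a prime field. -/

/-- Reduction of coefficients modulo a divisor. -/
noncomputable def reduceCoeff (X : Type) {m p : ℕ} (h : p ∣ m) : (X →₀ ZMod m) →+ (X →₀ ZMod p) :=
  Finsupp.mapRange.addMonoidHom (ZMod.castHom h (ZMod p)).toAddMonoidHom

theorem reduceCoeff_single {X : Type} {m p : ℕ} (h : p ∣ m) (x : X) (a : ZMod m) :
    reduceCoeff X h (Finsupp.single x a) = Finsupp.single x (ZMod.castHom h (ZMod p) a) := by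
  simp [reduceCoeff]

theorem reduceCoeff_surjective (X : Type) {m p : ℕ} (h : p ∣ m) :
    Function.Surjective (reduceCoeff X h) :=
  Finsupp.mapRange_surjective _ (map_zero _) (ZMod.castHom_surjective h)

theorem exists_eq_nsmul_of_reduceCoeff_eq_zero {X : Type} {m p : ℕ} [NeZero m] (h : p ∣ m)
    {f : X →₀ ZMod m} (hf : reduceCoeff X h f = 0) : ∃ g, f = p • g := by
  refine ⟨f.mapRange (fun a => ((a.val / p : ℕ) : ZMod m)) (by simp), ?_⟩
  ext x
  have h1 : ZMod.castHom h (ZMod p) (f x) = 0 := by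
    have := DFunLike.congr_fun hf x
    simpa [reduceCoeff] using this
  have h2 : p ∣ (f x).val := by
    rw [← ZMod.natCast_eq_zero_iff, ← h1, ← map_natCast (ZMod.castHom h (ZMod p)),
      ZMod.natCast_zmod_val]
  rw [Finsupp.smul_apply, Finsupp.mapRange_apply, nsmul_eq_mul, ← Nat.cast_mul,
    Nat.mul_div_cancel' h2, ZMod.natCast_zmod_val]

/-- Modulo a prime, a surjective semilinear endomorphism of a group algebra permutes the monomials
up to a scalar. -/
theorem exists_reduceCoeff_apply_eq {m p : ℕ} [Fact p.Prime] (hpm : p ∣ m) {X : Type}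
    [AddCommGroup X] [TwoUniqueSums X] (F : (X →₀ ZMod m) →+ (X →₀ ZMod m))
    (hF : Function.Surjective F) (α : X ≃+ X)
    (hFα : ∀ y f, F (Finsupp.domCongr (Equiv.addLeft y) f) =
      Finsupp.domCongr (Equiv.addLeft (α y)) (F f)) :
    ∃ (w : X) (c : ZMod p), ∀ f y,
      reduceCoeff X hpm (F f) y = c * reduceCoeff X hpm f (α.symm (y - w)) := by
  set r := reduceCoeff X hpm
  let U : AddMonoidAlgebra (ZMod p) X := .ofCoeff (r (F (Finsupp.single 0 1)))
  have hshift : ∀ (z : X) (f : X →₀ ZMod m) (a : ZMod p) (y : X),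
      a * r (Finsupp.domCongr (Equiv.addLeft z) f) y =
        (AddMonoidAlgebra.single z a * AddMonoidAlgebra.ofCoeff (r f)).coeff y := by
    intro z f a y
    rw [AddMonoidAlgebra.coeff_single_mul_apply]
    simp [r, reduceCoeff, Finsupp.domCongr, Finsupp.equivMapDomain_apply, add_comm]
  have hsingle : ∀ (x : X) (a : ZMod m), AddMonoidAlgebra.ofCoeff (r (F (Finsupp.single x a))) =
      AddMonoidAlgebra.single (α x) (ZMod.castHom hpm (ZMod p) a) * U := by
    intro x a
    -- F is only assumed additive; integer representatives make it compatible with scalars.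
    obtain ⟨a, rfl⟩ := ZMod.intCast_surjective a
    have h1 : Finsupp.single x (a : ZMod m) =
        a • Finsupp.domCongr (Equiv.addLeft x) (Finsupp.single 0 1) := by
      simp [Finsupp.domCongr, Finsupp.equivMapDomain_single]
    refine AddMonoidAlgebra.coeff_injective ?_
    ext y
    rw [← hshift, h1, map_zsmul, hFα, map_zsmul, map_intCast, AddMonoidAlgebra.coeff_ofCoeff,
      Finsupp.smul_apply, zsmul_eq_mul]
  let E : (X →₀ ZMod p) →+ AddMonoidAlgebra (ZMod p) X :=
    (AddMonoidHom.mulRight U).comp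
      (AddMonoidAlgebra.coeffAddEquiv.symm.toAddMonoidHom.comp
        (Finsupp.domCongr α.toEquiv).toAddMonoidHom)
  have hE : ∀ g, E g = AddMonoidAlgebra.ofCoeff (Finsupp.domCongr α.toEquiv g) * U := fun g => rfl
  have hall : ∀ f, AddMonoidAlgebra.ofCoeff (r (F f)) = E (r f) := by
    intro f
    have : (AddMonoidAlgebra.coeffAddEquiv.symm.toAddMonoidHom.comp (r.comp F)) = E.comp r := by
      refine Finsupp.addHom_ext fun x a => ?_
      refine (hsingle x a).trans ?_
      rw [AddMonoidHom.comp_apply, hE, reduceCoeff_single]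
      congr 1
      simp [Finsupp.domCongr, Finsupp.equivMapDomain_single]
    exact DFunLike.congr_fun this f
  have hU : IsUnit U := by
    -- A preimage of δ_0 under F yields an inverse of U.
    obtain ⟨f, hf⟩ := hF (Finsupp.single 0 1)
    have := hall f
    rw [hf, hE, reduceCoeff_single, map_one, AddMonoidAlgebra.ofCoeff_single,
      ← AddMonoidAlgebra.one_def, mul_comm] at this
    exact IsUnit.of_mul_eq_one _ this.symm
  obtain ⟨w, c, hU⟩ := AddMonoidAlgebra.exists_eq_single_of_isUnit hU
  refine ⟨w, c, fun f y => ?_⟩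
  have := congr_arg (fun g => g.coeff y) (hall f)
  simp only [hE, hU] at this
  rw [this, AddMonoidAlgebra.coeff_mul_single_apply, mul_comm]
  simp [Finsupp.domCongr, Finsupp.equivMapDomain_apply, sub_eq_add_neg]

/-! ### Finite cokernel implies surjectivity. -/

/-- A nontrivial finite abelian group killed by `m` is not `p`-divisible for some prime `p ∣ m`. -/
theorem exists_prime_not_surjective_nsmul {C : Type} [AddCommGroup C] [Finite C] [Nontrivial C]
    {m : ℕ} (hm : ∀ x : C, m • x = 0) :
    ∃ p : ℕ, p.Prime ∧ p ∣ m ∧ ¬ Function.Surjective fun x : C => p • x := by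
  have := Fintype.ofFinite C
  have h1 : Fintype.card C ≠ 1 := Fintype.one_lt_card.ne'
  obtain ⟨p, hp, hpc⟩ := Nat.exists_prime_and_dvd h1
  have := Fact.mk hp
  obtain ⟨x, hx⟩ := exists_prime_addOrderOf_dvd_card p hpc
  refine ⟨p, hp, ?_, fun h => ?_⟩
  · rw [← hx]
    exact addOrderOf_dvd_of_nsmul_eq_zero (hm x)
  · have h2 := Finite.injective_iff_surjective.2 h
    have h3 : x = 0 := h2 (by simp only [smul_zero]; rw [← hx, addOrderOf_nsmul_eq_zero])
    rw [h3, addOrderOf_zero] at hx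
    exact hp.one_lt.ne hx

/-- A surjective semilinear endomorphism `F` of the group algebra of a nontrivial finitely generated
torsion-free abelian group over `ℤ/m` such that `1 - F` has finite cokernel has `1 - F` surjective,
provided that `1 - α` has finite cokernel for the underlying automorphism `α`. -/
theorem surjective_id_sub_of_finite_quotient {m : ℕ} [NeZero m] {X : Type} [AddCommGroup X]
    [Module.Finite ℤ X] [IsAddTorsionFree X] [Nontrivial X]
    (F : (X →₀ ZMod m) →+ (X →₀ ZMod m)) (hF : Function.Surjective F) (α : X ≃+ X)
    (hFα : ∀ y f, F (Finsupp.domCongr (Equiv.addLeft y) f) =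
      Finsupp.domCongr (Equiv.addLeft (α y)) (F f))
    (hα : ∃ n : ℕ, 0 < n ∧ ∀ x, ∃ y, n • x = y - α y)
    [Finite ((X →₀ ZMod m) ⧸ (AddMonoidHom.id (X →₀ ZMod m) - F).range)] :
    Function.Surjective (AddMonoidHom.id (X →₀ ZMod m) - F) := by
  classical
  rw [← AddMonoidHom.range_eq_top]
  set R := (AddMonoidHom.id (X →₀ ZMod m) - F).range with hR
  by_contra hne
  have : Nontrivial ((X →₀ ZMod m) ⧸ R) := QuotientAddGroup.nontrivial_iff.2 hne
  obtain ⟨p, hp, hpm, hpC⟩ := exists_prime_not_surjective_nsmul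
    (C := (X →₀ ZMod m) ⧸ R) (m := m) (by
      intro x
      obtain ⟨f, rfl⟩ := QuotientAddGroup.mk_surjective x
      rw [← QuotientAddGroup.mk_nsmul]
      have : m • f = 0 := by ext y; simp
      rw [this, QuotientAddGroup.mk_zero])
  have := Fact.mk hp
  have : AddGroup.FG X := Module.Finite.iff_addGroup_fg.1 inferInstance
  have : AddMonoid.FG X := AddGroup.fg_iff_addMonoid_fg.1 inferInstance
  obtain ⟨w, c, hFc⟩ := exists_reduceCoeff_apply_eq hpm F hF α hFα
  set r := reduceCoeff X hpm with hr
  let β : Equiv.Perm X := α.toEquiv.trans (Equiv.addRight w)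
  have hβ : ∀ x, β x = α x + w := fun x => rfl
  have hβs : ∀ y, β.symm y = α.symm (y - w) := by
    intro y
    rw [Equiv.symm_apply_eq, hβ]
    simp
  obtain ⟨n, hn, hα⟩ := hα
  obtain ⟨y, hy⟩ := hα w
  have hy : α y + n • w = y := by rw [hy]; abel
  have hinf : ∀ x, n • x ≠ y → ∃ g : X →₀ ZMod p, ∀ z,
      g z - c * g (β.symm z) = Finsupp.single x 1 z := by
    intro x hx
    let D : X → X := fun x => x + (n • x - y)
    have hD : D.Injective := by
      intro a b hab
      refine nsmul_right_injective (n := 1 + n) (by lia) ?_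
      simp only [D] at hab
      simp only [add_smul, one_smul]
      have := congr_arg (· + y) hab
      simpa [add_assoc] using this
    have hDβ : ∀ z, D (β z) = β (D z) := by
      intro z
      simp only [D, hβ, map_add, map_sub, map_nsmul, smul_add]
      nth_rw 1 [← hy]
      abel
    -- Pigeonhole in the finite cokernel along the D-iterates of x.
    obtain ⟨i, j, hij, h⟩ := Finite.exists_ne_map_eq_of_infinite
      (fun t : ℕ => (QuotientAddGroup.mk (Finsupp.single (D^[t] x) 1) : (X →₀ ZMod m) ⧸ R))
    rw [QuotientAddGroup.eq, hR, AddMonoidHom.mem_range] at h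
    obtain ⟨f, hf⟩ := h
    refine exists_twistedDifference_eq_single (D := D^[i]) (x' := D^[j] x) (hD.iterate i)
      (fun z => (Function.Commute.iterate_left (f := D) (g := β) hDβ i) z)
      (not_sameCycle_iterate_homothety α hβ hn hy hx hij) (-(r f)) fun z => ?_
    have h1 := DFunLike.congr_fun (congr_arg r hf) z
    simp only [AddMonoidHom.sub_apply, AddMonoidHom.id_apply, map_sub, map_add, map_neg,
      Finsupp.sub_apply, Finsupp.add_apply, Finsupp.neg_apply, hr, reduceCoeff_single, map_one] at h1
    change r f z - r (F f) z = _ at h1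
    rw [hFc, ← hβs] at h1
    rw [Finsupp.neg_apply, Finsupp.neg_apply]
    linear_combination -h1
  have hsingle : ∀ x, ∃ g : X →₀ ZMod p, ∀ z, g z - c * g (β.symm z) = Finsupp.single x 1 z := by
    intro x
    by_cases hx : n • x = y
    · have hβx : β x = x := by
        refine nsmul_right_injective hn.ne' ?_
        simp only
        rw [hβ, smul_add, ← map_nsmul, hx, hy]
      have hc : c ≠ 1 := by
        rintro rfl
        obtain ⟨x', hx'⟩ := exists_ne x
        obtain ⟨g, hg⟩ := hinf x' (fun h => hx' (nsmul_right_injective hn.ne' (h.trans hx.symm)))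
        have h1 : g - Finsupp.domCongr β g = Finsupp.single x' 1 := by
          ext z
          rw [← hg z]
          simp [Finsupp.domCongr, Finsupp.equivMapDomain_apply]
        -- For c = 1 every g - g∘β⁻¹ has coefficient sum 0, whereas δ_{x'} has sum 1.
        have h2 := congr_arg (Finsupp.liftAddHom fun _ => AddMonoidHom.id (ZMod p)) h1
        rw [map_sub] at h2
        simp [Finsupp.domCongr, Finsupp.sum_equivMapDomain, -sub_self] at h2
        exact one_ne_zero (h2.symm.trans (sub_self _))
      have hc' : 1 - c ≠ 0 := sub_ne_zero.2 hc.symm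
      refine ⟨Finsupp.single x (1 - c)⁻¹, fun z => ?_⟩
      have h1 : x = β.symm z ↔ x = z := by rw [Equiv.eq_symm_apply, hβx]
      simp only [Finsupp.single_apply, h1]
      split_ifs
      · field_simp
      · simp
    · exact hinf x hx
  have hsurj : ∀ f : X →₀ ZMod p, ∃ g : X →₀ ZMod p, ∀ z, g z - c * g (β.symm z) = f z := by
    intro f
    induction f using Finsupp.induction_linear with
    | zero => exact ⟨0, by simp⟩
    | add f₁ f₂ h₁ h₂ =>
      obtain ⟨g₁, h₁⟩ := h₁
      obtain ⟨g₂, h₂⟩ := h₂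
      refine ⟨g₁ + g₂, fun z => ?_⟩
      rw [Finsupp.add_apply, Finsupp.add_apply, Finsupp.add_apply, ← h₁, ← h₂]
      ring
    | single x a =>
      obtain ⟨g, hg⟩ := hsingle x
      refine ⟨a • g, fun z => ?_⟩
      have : Finsupp.single x a z = a * Finsupp.single x (1 : ZMod p) z := by
        simp [Finsupp.single_apply]
      rw [this, ← hg, Finsupp.smul_apply, Finsupp.smul_apply, smul_eq_mul, smul_eq_mul]
      ring
  -- Lifting a solution modulo p changes f by an element of the image of 1-F into a multiple of p,
  -- so the cokernel is p-divisible, a contradiction.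
  refine hpC fun q => ?_
  obtain ⟨f, rfl⟩ := QuotientAddGroup.mk_surjective q
  obtain ⟨g, hg⟩ := hsurj (r f)
  obtain ⟨g, rfl⟩ := reduceCoeff_surjective X hpm g
  obtain ⟨k, hk⟩ := exists_eq_nsmul_of_reduceCoeff_eq_zero hpm (f := f - (g - F g)) (by
    ext z
    rw [map_sub, map_sub, Finsupp.sub_apply, Finsupp.sub_apply, ← hg, hFc, hβs, sub_self, Finsupp.zero_apply])
  refine ⟨QuotientAddGroup.mk k, ?_⟩
  simp only
  rw [← QuotientAddGroup.mk_nsmul, ← hk, QuotientAddGroup.eq]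
  exact ⟨g, by simp only [AddMonoidHom.sub_apply, AddMonoidHom.id_apply]; abel⟩

/-! ### Representations fixed by the twist. -/

/-- Burnside's theorem: an irreducible family of operators on a finite-dimensional complex space
spans the space of all operators, so that a functional `a ↦ tr (M a)` vanishing on it is zero. -/
theorem UnitaryRep.IsIrreducible.eq_zero_of_trace_comp_eq_zero {G V : Type} [Group G]
    [NormedAddCommGroup V] [InnerProductSpace ℂ V] [FiniteDimensional ℂ V] {ρ : UnitaryRep G V}
    (hρ : ρ.IsIrreducible) {M : Module.End ℂ V}
    (hM : ∀ g : G, LinearMap.trace ℂ V (M * (ρ g).toLinearEquiv.toLinearMap) = 0) : M = 0 := by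
  classical
  let ρ' : G →* Module.End ℂ V :=
    { toFun := fun g => (ρ g).toLinearEquiv.toLinearMap
      map_one' := by ext v; simp
      map_mul' := fun g h => by ext v; simp }
  let A := Algebra.adjoin ℂ (Set.range ρ')
  have : Nontrivial V := hρ.1
  have hsimple : IsSimpleModule A V := by
    refine { eq_bot_or_eq_top := fun W => ?_ }
    rcases hρ.2 (W.restrictScalars ℂ) (fun g v hv =>
      W.smul_mem (⟨ρ' g, Algebra.subset_adjoin ⟨g, rfl⟩⟩ : A) hv) with h | h
    · left
      exact Submodule.restrictScalars_injective ℂ A V (h.trans rfl)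
    · right
      exact Submodule.restrictScalars_injective ℂ A V (h.trans rfl)
  have hscal := (IsSimpleModule.algebraMap_end_bijective_of_isAlgClosed (A := A) (V := V) ℂ).2
  -- By Schur the commutant of A is ℂ, so every operator commutes with it; density on a basis then
  -- places the operator in A.
  have hA : ∀ a : Module.End ℂ V, a ∈ A := by
    intro a
    let f : Module.End (Module.End A V) V :=
      { toFun := a
        map_add' := a.map_add
        map_smul' := fun e v => by
          obtain ⟨c, rfl⟩ := hscal e
          exact a.map_smul c v }
    let B := Module.finBasis ℂ V
    obtain ⟨r, hr⟩ := jacobson_density f (Finset.univ.image B)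
    have : a = r := B.ext fun i => hr (B i) (Finset.mem_image_of_mem _ (Finset.mem_univ i))
    rw [this]
    exact r.2
  have hspan : ∀ a : Module.End ℂ V, LinearMap.trace ℂ V (M * a) = 0 := by
    intro a
    have ha := hA a
    rw [← Subalgebra.mem_toSubmodule, Algebra.adjoin_eq_span_of_subset _ (by
      rw [← MonoidHom.coe_mrange, Submonoid.closure_eq]
      exact Submodule.subset_span)] at ha
    induction ha using Submodule.span_induction with
    | mem a ha => obtain ⟨g, rfl⟩ := ha; exact hM g
    | zero => simp
    | add a b _ _ ha hb => rw [mul_add, map_add, ha, hb, add_zero]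
    | smul c a _ ha => rw [mul_smul_comm, map_smul, ha, smul_zero]
  ext v
  refine (Module.forall_dual_apply_eq_zero_iff ℂ (M v)).1 fun l => ?_
  rw [← LinearMap.trace_smulRight l (M v), ← hspan (l.smulRight v)]
  congr 1
  ext w
  simp

/-- If twisted conjugacy classes are the fibres of `π`, then an irreducible representation which is
equivalent to its twist is trivial on the kernel of `π`. -/
theorem UnitaryRep.IsIrreducible.apply_eq_of_equivalent_comp {G V Q : Type} [Group G] [Group Q]
    [NormedAddCommGroup V] [InnerProductSpace ℂ V] [FiniteDimensional ℂ V] {ρ : UnitaryRep G V}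
    (hρ : ρ.IsIrreducible) (φ : G ≃* G) (π : G →* Q)
    (hπ : ∀ g g', π g = π g' → ∃ h, g' = h * g * φ h⁻¹)
    (hφ : UnitaryRep.Equivalent ρ (ρ.comp φ.toMonoidHom)) {n : G} (hn : π n = 1) : ρ n = 1 := by
  obtain ⟨S, hS⟩ := hφ
  let L : (V ≃ₗᵢ[ℂ] V) →* Module.End ℂ V :=
    { toFun := fun T => T.toLinearEquiv.toLinearMap
      map_one' := by ext v; simp
      map_mul' := fun T U => by ext v; simp }
  have hSL : ∀ g, L S * L (ρ g) = L (ρ (φ g)) * L S := by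
    intro g
    ext v
    exact hS g v
  have hM : L S * L (ρ n) - L S = 0 := by
    refine hρ.eq_zero_of_trace_comp_eq_zero fun g => ?_
    change LinearMap.trace ℂ V ((L S * L (ρ n) - L S) * L (ρ g)) = 0
    -- Since n g = h g φ(h⁻¹), cyclicity of the trace and S ρ(h⁻¹) = ρ(φ(h⁻¹)) S give tr(S ρ(n g)) =
    -- tr(S ρ(g)).
    obtain ⟨h, hh⟩ := hπ g (n * g) (by rw [map_mul, hn, one_mul])
    have hLρ : ∀ a b, L (ρ a) * L (ρ b) = L (ρ (a * b)) := fun a b => by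
      rw [map_mul, map_mul]
    rw [sub_mul, map_sub, sub_eq_zero, mul_assoc, hLρ, hh, ← hLρ, ← mul_assoc,
      LinearMap.trace_mul_comm, ← mul_assoc, ← hSL, mul_assoc, hLρ, inv_mul_cancel_left]
  ext v
  have h1 := LinearMap.congr_fun (sub_eq_zero.1 hM) v
  exact S.injective h1

/-- The one-dimensional representation defined by a unitary character. -/
noncomputable def charRep {G : Type} [Group G] (χ : G →* Circle) :
    UnitaryRep G (EuclideanSpace ℂ (Fin 1)) where
  toFun g :=
    { DistribMulAction.toLinearEquiv ℂ (EuclideanSpace ℂ (Fin 1)) (χ g) with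
      norm_map' := fun v => Circle.norm_smul (χ g) v }
  map_one' := by
    ext1 v
    change χ 1 • v = v
    rw [map_one, one_smul]
  map_mul' g h := by
    ext1 v
    change χ (g * h) • v = χ g • χ h • v
    rw [map_mul, mul_smul]

/-- The irreducible representation defined by a unitary character. -/
noncomputable def charIrrep {G : Type} [Group G] (χ : G →* Circle) : FinDimIrrep G where
  dim := 1
  rep := charRep χ
  irreducible := by
    refine ⟨inferInstance, fun W _ => ?_⟩
    have : IsSimpleModule ℂ (EuclideanSpace ℂ (Fin 1)) :=
      isSimpleModule_iff_finrank_eq_one.2 (by simp)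
    exact eq_bot_or_eq_top W

theorem charIrrep_equiv_iff {G : Type} [Group G] {χ ψ : G →* Circle} :
    charIrrep χ ≈ charIrrep ψ ↔ χ = ψ := by
  constructor
  · rintro ⟨T, hT⟩
    ext g
    obtain ⟨v, hv⟩ := exists_ne (0 : EuclideanSpace ℂ (Fin 1))
    have h1 : T (χ g • v) = ψ g • T v := hT g v
    have h2 : T (χ g • v) = χ g • T v := T.map_smul (χ g : ℂ) v
    have h3 : T v ≠ 0 := fun h => hv (T.injective (h.trans (map_zero T).symm))
    exact smul_left_injective ℂ h3 (h2.symm.trans h1)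
  · rintro rfl
    exact Setoid.refl _

/-- An irreducible representation with commuting image acts by scalars and is one-dimensional. -/
theorem UnitaryRep.IsIrreducible.exists_scalar_of_commute {G V : Type} [Group G]
    [NormedAddCommGroup V] [InnerProductSpace ℂ V] [FiniteDimensional ℂ V] {ρ : UnitaryRep G V}
    (hρ : ρ.IsIrreducible) (hc : ∀ g h, ρ g * ρ h = ρ h * ρ g) :
    Module.finrank ℂ V = 1 ∧ ∃ c : G → Circle, ∀ g v, ρ g v = c g • v := by
  have : Nontrivial V := hρ.1
  obtain ⟨v, hv⟩ := exists_ne (0 : V)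
  have hscal : ∀ g, ∃ c : Circle, ∀ w, ρ g w = c • w := by
    intro g
    obtain ⟨c, hcg⟩ := Module.End.exists_eigenvalue (ρ g).toLinearEquiv.toLinearMap
    have htop := (hρ.2 (Module.End.eigenspace (ρ g).toLinearEquiv.toLinearMap c) (by
      intro h w hw
      rw [Module.End.mem_eigenspace_iff] at hw ⊢
      change ρ g w = c • w at hw
      change (ρ g * ρ h) w = c • ρ h w
      rw [hc, ← map_smul, ← hw]
      rfl)).resolve_left hcg
    have hw : ∀ w, ρ g w = c • w := fun w =>
      Module.End.mem_eigenspace_iff.1 (htop.ge (Submodule.mem_top (x := w)))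
    have hnorm : ‖c‖ = 1 := by
      have h1 := (ρ g).norm_map v
      rw [hw, norm_smul] at h1
      exact (mul_eq_right₀ (norm_ne_zero_iff.2 hv)).1 h1
    exact ⟨⟨c, mem_sphere_zero_iff_norm.2 hnorm⟩, hw⟩
  choose c hc' using hscal
  refine ⟨?_, c, hc'⟩
  refine finrank_eq_one_iff_of_nonzero v hv |>.2 ?_
  refine (hρ.2 (Submodule.span ℂ {v}) fun g w hw => ?_).resolve_left ?_
  · rw [hc']
    exact Submodule.smul_mem _ (c g : ℂ) hw
  · rwa [Submodule.span_singleton_eq_bot]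

/-- If the twisted conjugacy classes of `φ` are the fibres of a surjection onto a finite abelian
group `Q`, then the finite-dimensional irreducible representations fixed by `φ` are the characters
of `Q`, and the twisted Burnside–Frobenius theorem holds for `φ`. -/
theorem reidemeisterNumber_eq_card_fixedPoints_of_quotient {G Q : Type} [Group G] [AddCommGroup Q]
    [Finite Q] (φ : G ≃* G) (π : G →* Multiplicative Q) (hsurj : Function.Surjective π)
    (hπ : ∀ g g', π g = π g' ↔ ∃ h, g' = h * g * φ h⁻¹) :
    reidemeisterNumber φ = ENat.card (Function.fixedPoints (dualMap φ)) := by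
  have hπφ : ∀ h, π (φ h) = π h := by
    intro h
    have h1 := (hπ 1 (h * 1 * φ h⁻¹)).2 ⟨h, rfl⟩
    rw [mul_one, map_inv, map_mul, map_inv, map_one, eq_comm, mul_inv_eq_one] at h1
    exact h1.symm
  have hR : reidemeisterNumber φ = ENat.card Q := by
    refine ENat.card_congr (Equiv.ofBijective
      (Quotient.lift (fun g => (π g).toAdd) fun g g' h => congr_arg _ ((hπ g g').2 h)) ⟨?_, ?_⟩)
    · rintro ⟨g⟩ ⟨g'⟩ h
      exact Quotient.sound ((hπ g g').1 h)
    · intro q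
      obtain ⟨g, hg⟩ := hsurj (Multiplicative.ofAdd q)
      exact ⟨Quotient.mk _ g, by simp [hg]⟩
  let f : AddChar Q Circle → FinDimUnitaryDual G := fun ψ =>
    Quotient.mk _ (charIrrep (ψ.toMonoidHom.comp π))
  have hf : ∀ ψ, f ψ ∈ Function.fixedPoints (dualMap φ) := by
    intro ψ
    have h1 : (charIrrep (ψ.toMonoidHom.comp π)).twist φ ≈ charIrrep (ψ.toMonoidHom.comp π) := by
      refine ⟨LinearIsometryEquiv.refl ℂ _, fun g v => ?_⟩
      change ψ.toMonoidHom (π (φ g)) • v = ψ.toMonoidHom (π g) • v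
      rw [hπφ]
    exact Quotient.sound h1
  have hinj : Function.Injective f := by
    intro ψ ψ' h
    have h1 := charIrrep_equiv_iff.1 (Quotient.exact h)
    ext q
    obtain ⟨g, hg⟩ := hsurj (Multiplicative.ofAdd q)
    have h2 := DFunLike.congr_fun h1 g
    rw [MonoidHom.comp_apply, MonoidHom.comp_apply, hg] at h2
    exact congr_arg Subtype.val h2
  have hrange : ∀ x ∈ Function.fixedPoints (dualMap φ), ∃ ψ, f ψ = x := by
    rintro ⟨⟨d, ρ, hρ⟩⟩ hx
    have hx : UnitaryRep.Equivalent ρ (ρ.comp φ.toMonoidHom) := Setoid.symm (Quotient.exact hx)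
    have hker : ∀ g h, π g = π h → ρ g = ρ h := by
      intro g h hgh
      have h1 := hρ.apply_eq_of_equivalent_comp φ π (fun g g' => (hπ g g').1) hx (n := g * h⁻¹)
        (by rw [map_mul, map_inv, hgh, mul_inv_cancel])
      rwa [map_mul, map_inv, mul_inv_eq_one] at h1
    obtain ⟨hd, c, hc⟩ := hρ.exists_scalar_of_commute fun g h => by
      rw [← map_mul, ← map_mul]
      exact hker _ _ (by rw [map_mul, map_mul, mul_comm])
    rw [finrank_euclideanSpace_fin] at hd
    subst hd
    obtain ⟨v, hv⟩ := exists_ne (0 : EuclideanSpace ℂ (Fin 1))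
    have hcπ : ∀ g (a : Circle), ρ g v = a • v → c g = a := by
      intro g a ha
      rw [hc] at ha
      exact Subtype.ext (smul_left_injective ℂ hv ha)
    -- Only a set-theoretic section: ρ is constant on fibres of π, so `ψ` is still additive.
    let s : Q → G := fun q => Function.surjInv hsurj (Multiplicative.ofAdd q)
    have hs : ∀ q, π (s q) = Multiplicative.ofAdd q := fun q => Function.surjInv_eq hsurj _
    let ψ : AddChar Q Circle :=
      { toFun := fun q => c (s q)
        map_zero_eq_one' := hcπ _ _ (by
          rw [hker (s 0) 1 (by rw [hs, map_one, ofAdd_zero]), map_one, one_smul]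
          rfl)
        map_add_eq_mul' := fun a b => hcπ _ _ (by
          rw [hker (s (a + b)) (s a * s b) (by rw [map_mul, hs, hs, hs, ofAdd_add]), map_mul,
            mul_smul, ← hc, ← hc]
          rfl) }
    have hψ : ∀ g w, ρ g w = ψ.toMonoidHom (π g) • w := by
      intro g w
      rw [hker g (s (π g).toAdd) (by rw [hs, ofAdd_toAdd]), hc]
      rfl
    refine ⟨ψ, ?_⟩
    have h1 : charIrrep (ψ.toMonoidHom.comp π) ≈ ⟨1, ρ, hρ⟩ :=
      ⟨LinearIsometryEquiv.refl ℂ _, fun g w => (hψ g w).symm⟩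
    exact Quotient.sound h1
  have hcard : ENat.card (AddChar Q Circle) = ENat.card Q := by
    have := Fintype.ofFinite Q
    rw [ENat.card_congr AddChar.circleEquivComplex.toEquiv, ENat.card_eq_coe_fintype_card,
      ENat.card_eq_coe_fintype_card, AddChar.card_eq]
  rw [hR, ← hcard]
  exact ENat.card_congr (Equiv.ofBijective (fun ψ => ⟨f ψ, hf ψ⟩)
    ⟨fun ψ ψ' h => hinj (Subtype.ext_iff.1 h), fun ⟨x, hx⟩ => by
      obtain ⟨ψ, h⟩ := hrange x hx
      exact ⟨ψ, Subtype.ext h⟩⟩)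

/-! ### Automorphisms and twisted classes of the wreath product. -/

/-- An endomorphism of a finitely generated torsion-free abelian group whose cokernel is finite is
injective. -/
theorem injective_of_finite_quotient_range {X : Type} [AddCommGroup X] [Module.Finite ℤ X]
    [IsAddTorsionFree X] (T : X →+ X) [Finite (X ⧸ T.range)] : Function.Injective T := by
  let T' : X →ₗ[ℤ] X := T.toIntLinearMap
  have hfin : Finite (X ⧸ LinearMap.range T') := ‹Finite (X ⧸ T.range)›
  have h0 : Module.finrank ℤ (X ⧸ LinearMap.range T') = 0 := by
    rw [Module.finrank_eq_zero_iff_isTorsion, Module.IsTorsion]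
    intro x
    refine ⟨⟨(Nat.card (X ⧸ LinearMap.range T') : ℤ), ?_⟩, ?_⟩
    · exact mem_nonZeroDivisors_of_ne_zero (by exact_mod_cast Nat.card_pos.ne')
    · change (Nat.card (X ⧸ LinearMap.range T') : ℤ) • x = 0
      rw [natCast_zsmul, card_nsmul_eq_zero']
  have h1 := Submodule.finrank_quotient_add_finrank (LinearMap.range T')
  have h2 := Submodule.finrank_quotient_add_finrank (LinearMap.ker T')
  have h3 := T'.quotKerEquivRange.finrank_eq
  have h4 : LinearMap.ker T' = ⊥ := Submodule.finrank_eq_zero.1 (by lia)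
  exact LinearMap.ker_eq_bot.1 h4

namespace RestrictedWreath

variable {A X : Type} [AddCommGroup A] [AddCommGroup X]

/-- The element `(f, x)` of the restricted wreath product, in additive notation. -/
def mk (f : X →₀ A) (x : X) : RestrictedWreath A X :=
  ⟨Multiplicative.ofAdd f, Multiplicative.ofAdd x⟩

theorem mk_surjective (g : RestrictedWreath A X) : ∃ f x, mk f x = g :=
  ⟨g.left.toAdd, g.right.toAdd, rfl⟩

theorem mk_inj {f f' : X →₀ A} {x x' : X} : mk f x = mk f' x' ↔ f = f' ∧ x = x' := by
  constructor
  · intro h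
    exact ⟨congr_arg (fun g => g.left.toAdd) h, congr_arg (fun g => g.right.toAdd) h⟩
  · rintro ⟨rfl, rfl⟩
    rfl

theorem mk_mul (f f' : X →₀ A) (x x' : X) :
    mk f x * mk f' x' = mk (f + Finsupp.domCongr (Equiv.addLeft x) f') (x + x') := rfl

theorem mk_zero_zero : (mk 0 0 : RestrictedWreath A X) = 1 := rfl

theorem domCongr_addLeft_zero (f : X →₀ A) : Finsupp.domCongr (Equiv.addLeft (0 : X)) f = f := by
  ext y
  simp only [Finsupp.domCongr, AddEquiv.coe_mk, Equiv.coe_fn_mk, Finsupp.equivMapDomain_apply,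
    Equiv.addLeft_symm, Equiv.coe_addLeft, neg_zero, zero_add]

theorem domCongr_addLeft_comm (x y : X) (f : X →₀ A) :
    Finsupp.domCongr (Equiv.addLeft x) (Finsupp.domCongr (Equiv.addLeft y) f) =
      Finsupp.domCongr (Equiv.addLeft y) (Finsupp.domCongr (Equiv.addLeft x) f) := by
  ext z
  simp only [Finsupp.domCongr, AddEquiv.coe_mk, Equiv.coe_fn_mk, Finsupp.equivMapDomain_apply,
    Equiv.addLeft_symm, Equiv.coe_addLeft]
  rw [add_left_comm]

theorem mk_zero_pow (f : X →₀ A) (n : ℕ) : mk f 0 ^ n = mk (n • f) 0 := by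
  induction n with
  | zero => rw [pow_zero, zero_smul, mk_zero_zero]
  | succ n ih => rw [pow_succ, ih, mk_mul, domCongr_addLeft_zero, add_zero, succ_nsmul]

/-- If `A` has finite exponent and `X` is torsion-free, every endomorphism of the wreath product
preserves the base group. -/
theorem right_apply_mk_zero [IsAddTorsionFree X] {m : ℕ} (hm : m ≠ 0) (hA : ∀ a : A, m • a = 0)
    (φ : RestrictedWreath A X →* RestrictedWreath A X) (f : X →₀ A) :
    ∃ f', φ (mk f 0) = mk f' 0 := by
  obtain ⟨f', x, h⟩ := mk_surjective (φ (mk f 0))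
  have h1 : (mk f 0) ^ m = 1 := by
    have : m • f = 0 := by
      ext y
      exact hA (f y)
    rw [mk_zero_pow, this, mk_zero_zero]
  have h2 : (mk f' x).right ^ m = 1 := by
    have h3 := congr_arg SemidirectProduct.rightHom (congr_arg φ h1)
    rwa [map_pow, ← h, map_one, map_one, map_pow] at h3
  have h4 : m • x = 0 := h2
  have h5 : x = 0 := nsmul_right_injective hm (by simpa using h4)
  exact ⟨f', by rw [← h, h5]⟩

/-- The structure of endomorphisms of the wreath product: an endomorphism `F` of the base group
which is semilinear over an endomorphism `α` of `X`, and a twisting function `b`. -/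
theorem exists_endomorphism_eq [IsAddTorsionFree X] {m : ℕ} (hm : m ≠ 0) (hA : ∀ a : A, m • a = 0)
    (φ : RestrictedWreath A X →* RestrictedWreath A X) :
    ∃ (F : (X →₀ A) →+ (X →₀ A)) (α : X →+ X) (b : X → X →₀ A),
      (∀ f x, φ (mk f x) = mk (F f + b x) (α x)) ∧
      ∀ y f, F (Finsupp.domCongr (Equiv.addLeft y) f) =
        Finsupp.domCongr (Equiv.addLeft (α y)) (F f) := by
  choose F hF using right_apply_mk_zero hm hA φ
  choose b α hbα using fun x => mk_surjective (φ (mk 0 x))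
  have hφ : ∀ f x, φ (mk f x) = mk (F f + b x) (α x) := by
    intro f x
    have h1 : mk f x = mk f 0 * mk 0 x := by
      rw [mk_mul, map_zero, add_zero, zero_add]
    rw [h1, map_mul, hF, ← hbα, mk_mul, domCongr_addLeft_zero, zero_add]
  have hFadd : ∀ f f', F (f + f') = F f + F f' := by
    intro f f'
    have h1 := congr_arg φ (mk_mul f f' 0 0)
    rw [map_mul, hF, hF, mk_mul, domCongr_addLeft_zero, domCongr_addLeft_zero, add_zero, hF] at h1
    exact (mk_inj.1 h1).1.symm
  have hαadd : ∀ x y, α (x + y) = α x + α y := by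
    intro x y
    have h1 := congr_arg φ (mk_mul (0 : X →₀ A) 0 x y)
    rw [map_mul, ← hbα, ← hbα, mk_mul, map_zero, add_zero, ← hbα] at h1
    exact (mk_inj.1 h1).2.symm
  refine ⟨AddMonoidHom.mk' F hFadd, AddMonoidHom.mk' α hαadd, b, hφ, fun y f => ?_⟩
  -- Semilinearity is the image under φ of the commutation rule between X and the base group.
  have h1 : mk 0 y * mk f 0 = mk (Finsupp.domCongr (Equiv.addLeft y) f) 0 * mk 0 y := by
    rw [mk_mul, mk_mul, map_zero, add_zero, zero_add, add_zero, zero_add]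
  have h2 := congr_arg φ h1
  rw [map_mul, map_mul, hF, hF, ← hbα, mk_mul, mk_mul, domCongr_addLeft_zero, add_comm] at h2
  exact (add_right_cancel (mk_inj.1 h2).1).symm

/-- The structure of automorphisms of the wreath product. -/
theorem exists_automorphism_eq [IsAddTorsionFree X] {m : ℕ} (hm : m ≠ 0) (hA : ∀ a : A, m • a = 0)
    (φ : RestrictedWreath A X ≃* RestrictedWreath A X) :
    ∃ (F : (X →₀ A) →+ (X →₀ A)) (α : X ≃+ X) (b : X → X →₀ A),
      (∀ f x, φ (mk f x) = mk (F f + b x) (α x)) ∧ Function.Surjective F ∧ b 0 = 0 ∧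
      ∀ y f, F (Finsupp.domCongr (Equiv.addLeft y) f) =
        Finsupp.domCongr (Equiv.addLeft (α y)) (F f) := by
  obtain ⟨F, α, b, hφ, hF⟩ := exists_endomorphism_eq hm hA φ.toMonoidHom
  obtain ⟨F', α', b', hφ', -⟩ := exists_endomorphism_eq hm hA φ.symm.toMonoidHom
  have hφ : ∀ f x, φ (mk f x) = mk (F f + b x) (α x) := hφ
  have hφ' : ∀ f x, φ.symm (mk f x) = mk (F' f + b' x) (α' x) := hφ'
  have hb : b 0 = 0 := by
    have h1 := hφ 0 0
    rw [mk_zero_zero, map_one, ← mk_zero_zero, map_zero, zero_add] at h1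
    exact (mk_inj.1 h1).1.symm
  have hb' : b' 0 = 0 := by
    have h1 := hφ' 0 0
    rw [mk_zero_zero, map_one, ← mk_zero_zero, map_zero, zero_add] at h1
    exact (mk_inj.1 h1).1.symm
  have h1 : ∀ x, α' (α x) = x := by
    intro x
    have h1 := φ.symm_apply_apply (mk 0 x)
    rw [hφ, hφ'] at h1
    exact (mk_inj.1 h1).2
  have h2 : ∀ x, α (α' x) = x := by
    intro x
    have h2 := φ.apply_symm_apply (mk 0 x)
    rw [hφ', hφ] at h2
    exact (mk_inj.1 h2).2
  refine ⟨F, { α with invFun := α', left_inv := h1, right_inv := h2 }, b, hφ, fun f => ?_, hb, hF⟩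
  have h3 := φ.apply_symm_apply (mk f 0)
  rw [hφ', hφ, map_zero, hb, hb', add_zero, add_zero] at h3
  exact ⟨_, (mk_inj.1 h3).1⟩

/-- Twisted conjugacy in terms of the structure of the automorphism. -/
theorem twistedConj_iff {φ : RestrictedWreath A X ≃* RestrictedWreath A X}
    {F : (X →₀ A) →+ (X →₀ A)} {α : X ≃+ X} {b : X → X →₀ A}
    (hφ : ∀ f x, φ (mk f x) = mk (F f + b x) (α x)) {f f' : X →₀ A} {x x' : X} :
    (∃ h, mk f' x' = h * mk f x * φ h⁻¹) ↔
      ∃ k y, f' + Finsupp.domCongr (Equiv.addLeft x') (F k + b y) =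
        k + Finsupp.domCongr (Equiv.addLeft y) f ∧ x' + α y = y + x := by
  constructor
  · rintro ⟨h, hh⟩
    obtain ⟨k, y, rfl⟩ := mk_surjective h
    rw [map_inv, eq_mul_inv_iff_mul_eq, hφ, mk_mul, mk_mul, mk_inj] at hh
    exact ⟨k, y, hh⟩
  · rintro ⟨k, y, hh⟩
    refine ⟨mk k y, ?_⟩
    rwa [map_inv, eq_mul_inv_iff_mul_eq, hφ, mk_mul, mk_mul, mk_inj]

/-- `TBFT_f` for restricted wreath products of a finite cyclic group with a finitely generated
torsion-free abelian group. -/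
theorem tbftf (m : ℕ) [NeZero m] (X : Type) [AddCommGroup X] [Module.Finite ℤ X]
    [IsAddTorsionFree X] : TBFTf (RestrictedWreath (ZMod m) X) := by
  intro φ hR
  have hfin : Finite (Quotient (reidemeisterSetoid φ)) := ENat.card_lt_top.1 hR
  obtain ⟨F, α, b, hφ, hFs, hb, hF⟩ := exists_automorphism_eq (NeZero.ne m) (by simp) φ
  let T : X →+ X := AddMonoidHom.id X - α.toAddMonoidHom
  have hT : ∀ y, T y = y - α y := fun y => rfl
  have hmk : ∀ x x' : X, (QuotientAddGroup.mk x : X ⧸ T.range) = QuotientAddGroup.mk x' ↔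
      ∃ y, x' + α y = y + x := by
    intro x x'
    rw [QuotientAddGroup.eq, AddMonoidHom.mem_range]
    refine exists_congr fun y => ?_
    rw [hT, sub_eq_iff_eq_add, eq_comm (a := y), ← sub_eq_zero, ← sub_eq_zero (a := x' + α y)]
    have : -x + x' + α y - y = x' + α y - (y + x) := by abel
    rw [this]
  have hQ : Finite (X ⧸ T.range) := by
    refine Finite.of_surjective (α := Quotient (reidemeisterSetoid φ)) (Quotient.lift
      (fun g : RestrictedWreath (ZMod m) X => (QuotientAddGroup.mk g.right.toAdd : X ⧸ T.range))
      fun g g' h => ?_) fun q => ?_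
    · obtain ⟨f, x, rfl⟩ := mk_surjective g
      obtain ⟨f', x', rfl⟩ := mk_surjective g'
      obtain ⟨k, y, -, hy⟩ := (twistedConj_iff hφ).1 h
      exact (hmk x x').2 ⟨y, hy⟩
    · obtain ⟨x, rfl⟩ := QuotientAddGroup.mk_surjective q
      exact ⟨Quotient.mk _ (mk 0 x), rfl⟩
  have hTinj := injective_of_finite_quotient_range T
  let L : X → (X →₀ ZMod m) →+ (X →₀ ZMod m) := fun z =>
    (Finsupp.domCongr (Equiv.addLeft z)).toAddMonoidHom.comp F
  have hLfin : ∀ z, Finite ((X →₀ ZMod m) ⧸ (AddMonoidHom.id (X →₀ ZMod m) - L z).range) := by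
    intro z
    refine Finite.of_injective (β := Quotient (reidemeisterSetoid φ))
      (fun q => Quotient.mk _ (mk q.out z)) fun q q' h => ?_
    obtain ⟨k, y, hk, hy⟩ := (twistedConj_iff hφ).1 (Quotient.exact h)
    -- Conjugating within the fibre over z forces y = α y, so only base elements contribute.
    have hy0 : y = 0 := hTinj (by
      rw [hT, map_zero, sub_eq_zero]
      exact (add_left_cancel (hy.trans (add_comm y z))).symm)
    rw [hy0, hb, add_zero, domCongr_addLeft_zero] at hk
    rw [← QuotientAddGroup.out_eq' q, ← QuotientAddGroup.out_eq' q', QuotientAddGroup.eq]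
    refine ⟨k, ?_⟩
    change k - Finsupp.domCongr (Equiv.addLeft z) (F k) = _
    rw [sub_eq_iff_eq_add, add_assoc, hk]
    abel
  rcases subsingleton_or_nontrivial X with hX | hX
  · have := hLfin 0
    let π : RestrictedWreath (ZMod m) X →*
        Multiplicative ((X →₀ ZMod m) ⧸ (AddMonoidHom.id (X →₀ ZMod m) - L 0).range) :=
      { toFun := fun g => Multiplicative.ofAdd (QuotientAddGroup.mk g.left.toAdd)
        map_one' := rfl
        map_mul' := fun g g' => by
          obtain ⟨f, x, rfl⟩ := mk_surjective g
          obtain ⟨f', x', rfl⟩ := mk_surjective g'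
          rw [mk_mul, Subsingleton.elim x 0, domCongr_addLeft_zero]
          rfl }
    refine reidemeisterNumber_eq_card_fixedPoints_of_quotient
      (Q := (X →₀ ZMod m) ⧸ (AddMonoidHom.id (X →₀ ZMod m) - L 0).range) φ π (fun q => ?_) fun g g' => ?_
    · obtain ⟨f, hf⟩ := QuotientAddGroup.mk_surjective q.toAdd
      exact ⟨mk f 0, congr_arg Multiplicative.ofAdd hf⟩
    · obtain ⟨f, x, rfl⟩ := mk_surjective g
      obtain ⟨f', x', rfl⟩ := mk_surjective g'
      rw [twistedConj_iff hφ]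
      refine (QuotientAddGroup.eq (a := f) (b := f')).trans (exists_congr fun k => ?_)
      rw [Subsingleton.elim x 0, Subsingleton.elim x' 0]
      have h1 : (∃ y : X, f' + Finsupp.domCongr (Equiv.addLeft (0 : X)) (F k + b y) =
          k + Finsupp.domCongr (Equiv.addLeft y) f ∧ 0 + α y = y + 0) ↔ f' + F k = k + f := by
        constructor
        · rintro ⟨y, hy, -⟩
          rwa [Subsingleton.elim y 0, domCongr_addLeft_zero, domCongr_addLeft_zero, hb,
            add_zero] at hy
        · intro h
          refine ⟨0, ?_, Subsingleton.elim _ _⟩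
          rwa [domCongr_addLeft_zero, domCongr_addLeft_zero, hb, add_zero]
      rw [h1]
      change k - Finsupp.domCongr (Equiv.addLeft (0 : X)) (F k) = _ ↔ _
      rw [domCongr_addLeft_zero, sub_eq_iff_eq_add, eq_comm, ← sub_eq_zero,
        ← sub_eq_zero (a := f' + F k)]
      have : -f + f' + F k - k = f' + F k - (k + f) := by abel
      rw [this]
  · have hLs : ∀ z, Function.Surjective (AddMonoidHom.id (X →₀ ZMod m) - L z) := by
      intro z
      have := hLfin z
      refine surjective_id_sub_of_finite_quotient (L z)
        ((Finsupp.domCongr (Equiv.addLeft z)).surjective.comp hFs) α (fun y f => ?_)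
        ⟨Nat.card (X ⧸ T.range), Nat.card_pos, fun x => ?_⟩
      · change Finsupp.domCongr (Equiv.addLeft z) (F _) = _
        rw [hF, domCongr_addLeft_comm]
        rfl
      · have h1 : (QuotientAddGroup.mk (Nat.card (X ⧸ T.range) • x) : X ⧸ T.range) = 0 := by
          rw [QuotientAddGroup.mk_nsmul, card_nsmul_eq_zero']
        obtain ⟨y, hy⟩ := (QuotientAddGroup.eq_zero_iff _).1 h1
        exact ⟨y, hy.symm⟩
    let π : RestrictedWreath (ZMod m) X →* Multiplicative (X ⧸ T.range) :=
      (AddMonoidHom.toMultiplicative (QuotientAddGroup.mk' T.range)).comp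
        SemidirectProduct.rightHom
    refine reidemeisterNumber_eq_card_fixedPoints_of_quotient φ π (fun q => ?_) fun g g' => ?_
    · obtain ⟨x, hx⟩ := QuotientAddGroup.mk_surjective q.toAdd
      exact ⟨mk 0 x, congr_arg Multiplicative.ofAdd hx⟩
    · obtain ⟨f, x, rfl⟩ := mk_surjective g
      obtain ⟨f', x', rfl⟩ := mk_surjective g'
      rw [twistedConj_iff hφ]
      refine (hmk x x').trans ⟨?_, fun ⟨k, y, _, hy⟩ => ⟨y, hy⟩⟩
      rintro ⟨y, hy⟩
      -- With y fixed by the X-components, the base components impose an equation (1 - L x') k =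
      -- known term.
      obtain ⟨k, hk⟩ := hLs x' (f' + Finsupp.domCongr (Equiv.addLeft x') (b y) -
        Finsupp.domCongr (Equiv.addLeft y) f)
      refine ⟨k, y, ?_, hy⟩
      change k - Finsupp.domCongr (Equiv.addLeft x') (F k) = _ at hk
      conv_rhs => rw [sub_eq_iff_eq_add.1 hk]
      rw [map_add]
      abel

end RestrictedWreath

/-! ### The three families. -/

theorem mainTheorem4 :
    (∀ m : ℕ, Nat.Coprime m 6 → TBFTf (RestrictedWreath (ZMod m) ℤ)) ∧
    (∀ p k : ℕ, p.Prime → 3 < p → TBFTf (RestrictedWreath (ZMod p) (Fin k → ℤ))) ∧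
    (∀ d : ℕ, TBFTf (RestrictedWreath (ZMod 3) (Fin (2 * d) → ℤ))) := by
  refine ⟨fun m hm => ?_, fun p k hp _ => ?_, fun d => RestrictedWreath.tbftf 3 _⟩
  -- The case m = 0 is excluded by gcd(0, 6) = 6.
  · have : NeZero m := ⟨by rintro rfl; norm_num at hm⟩
    exact RestrictedWreath.tbftf m ℤ
  · have : NeZero p := ⟨hp.ne_zero⟩
    exact RestrictedWreath.tbftf p _
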